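/- Consider four planar point vortices at distinct positions $x_1,\dots,x_4\in\mathbb{R}^2$ with strengths $\Gamma_1=\Gamma_2=1$ and $\Gamma_3=\Gamma_4=m$, where $m<0$ and $m\neq-1$ (so that the total circulation $\Gamma=\sum_i\Gamma_i=2+2m$ is nonzero). The configuration is a relative equilibrium with angular velocity $\lambda\neq0$ if for some point $c\in\mathbb{R}^2$ $$-\lambda(x_i-c)=\sum_{j\neq i}\frac{\Gamma_j}{\|x_i-x_j\|^2}(x_j-x_i),\qquad i=1,\dots,4,$$ and one sets $\lambda'=-\lambda/\Gamma$. Consider the relative equilibria with $\lambda'>0$ that are kites with vortices 1 and 2 on the axis of symmetry (that is, vortices 1 and 2 lie on a line about which vortices 3 and 4 are distinct mirror images of each other) but are not rhombi, that is, not all of the four distances $\|x_1-x_3\|,\|x_3-x_2\|,\|x_2-x_4\|,\|x_4-x_1\|$ are equal. Configurations with labelled vortices are counted up to translation, rotation and scaling; configurations that differ by a reflection are counted separately. The cubic $9t^3+3t^2+7t+5$ has exactly one real root $m^*\approx-0.5951$. If $m^*<m<-1/2$, there are exactly four such relative equilibria, and all of them are convex: the four vortices are the vertices of a strictly convex quadrilateral.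 For all other $m<0$ with $m\neq-1$, there are none. -/

import Mathlib

/-- `x` is a relative equilibrium (central configuration) of four planar point vortices with
strengths `Γ`, rotating with angular velocity `ω ≠ 0` about some point `c`: the positions are
distinct and `-ω (x i - c) = ∑_{j ≠ i} Γ j / r_{ij}² • (x j - x i)` for each `i`.
The plane is `ℂ`, with its Euclidean distance. -/
def IsRelativeEquilibrium (Γ : Fin 4 → ℝ) (x : Fin 4 → ℂ) (ω : ℝ) : Prop :=
  Function.Injective x ∧ ω ≠ 0 ∧
    ∃ c : ℂ, ∀ i, (-ω) • (x i - c) =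
      ∑ j ∈ Finset.univ.erase i, (Γ j / dist (x i) (x j) ^ 2) • (x j - x i)

/-- The normalized multiplier `λ' = -λ / Γ_total`; meaningful only for nonzero total circulation. -/
noncomputable def lambdaPrime (Γ : Fin 4 → ℝ) (ω : ℝ) : ℝ := -ω / ∑ i, Γ i

/-- The vortex strengths `Γ₁ = Γ₂ = 1`, `Γ₃ = Γ₄ = m`. Vortex `k` has index `k - 1`. -/
def strengths (m : ℝ) : Fin 4 → ℝ := ![1, 1, m, m]

/-- Kite with vortices 1 and 2 on the axis of symmetry and vortices 3 and 4 (distinct) mirror images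
of each other; the axis is then the perpendicular bisector of vortices 3 and 4. -/
def IsKite12 (x : Fin 4 → ℂ) : Prop :=
  x 2 ≠ x 3 ∧ x 0 ∈ AffineSubspace.perpBisector (x 2) (x 3) ∧
    x 1 ∈ AffineSubspace.perpBisector (x 2) (x 3)

/-- Rhombus with vortices 1, 2 opposite each other and vortices 3, 4 opposite each other. -/
def IsRhombus (x : Fin 4 → ℂ) : Prop :=
  dist (x 0) (x 2) = dist (x 2) (x 1) ∧ dist (x 2) (x 1) = dist (x 1) (x 3) ∧
    dist (x 1) (x 3) = dist (x 3) (x 0)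

/-- The kite relative equilibria with strengths `1, 1, m, m`, vortices 1 and 2 on the axis,
`λ' > 0`, that are not rhombi; convex or not. -/
def kitesLamPos (m : ℝ) : Set (Fin 4 → ℂ) :=
  {x | (∃ ω : ℝ, IsRelativeEquilibrium (strengths m) x ω ∧ 0 < lambdaPrime (strengths m) ω) ∧
    IsKite12 x ∧ ¬ IsRhombus x}

/-- Labelled configurations are identified under translation, rotation and scaling
(`z ↦ a z + b` with `a ≠ 0`), but not under reflection or relabelling. -/
abbrev configSetoid : Setoid (Fin 4 → ℂ) where
  r x y := ∃ a b : ℂ, a ≠ 0 ∧ ∀ i, y i = a * x i + b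
  iseqv :=
    { refl := fun x => ⟨1, 0, one_ne_zero, fun i => by simp⟩
      symm := by
        rintro x y ⟨a, b, ha, h⟩
        refine ⟨a⁻¹, -(a⁻¹ * b), inv_ne_zero ha, fun i => ?_⟩
        rw [h i]
        field_simp
        ring
      trans := by
        rintro x y z ⟨a, b, ha, h⟩ ⟨a', b', ha', h'⟩
        refine ⟨a' * a, a' * b + b', mul_ne_zero ha' ha, fun i => ?_⟩
        rw [h' i, h i]
        ring }

/-- The equivalence classes represented by a set of configurations. -/
def configClasses (S : Set (Fin 4 → ℂ)) : Set (Quotient configSetoid) :=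
  Quotient.mk configSetoid '' S

/-! A similarity puts vortices 3 and 4 at `±I` and vortices 1 and 2 at real `a`, `b`. Weighting the
equations by the strengths eliminates the centre and leaves three equations in `a`, `b` and `l = λ'`
(`normalKite_mem_iff`). Put `p = -(a * b)`. If the kite is not a rhombus (`a + b ≠ 0`) and `l > 0`,
eliminating `l` gives `m < -1/2`, `p > 1`, a formula for `(a - b)²` in terms of `p`, and a quadratic
for `p`; conversely these yield a positive `l` (`kiteEquations_iff`).

Write `m = -(1 + w²) / 2`. Then `(a + b)² > 0` means `p (1 - 2w) > 1`, so roots beyond `1 / (1 -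
2w)` are wanted. The leading coefficient is positive, so a negative value there gives exactly one
such root; otherwise there is none, by monotonicity of the reciprocal quadratic. The sign of that
value is governed by a quartic in `w`, whose product with its image under `w ↦ -w` is the cubic in
`m` up to a positive factor. The root `p` fixes `a - b` and `a + b` up to independent signs: four
kites. Convexity follows from `a * b < 0`. -/

/-! ### The cubic and its sign -/

theorem exists_cubic_root :
    ∃ r : ℝ, |r - (-0.5951)| < 0.00005 ∧ 9 * r ^ 3 + 3 * r ^ 2 + 7 * r + 5 = 0 := by
  have hc : ContinuousOn (fun t : ℝ => 9 * t ^ 3 + 3 * t ^ 2 + 7 * t + 5)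
      (Set.Icc (-0.59515) (-0.59505)) := by fun_prop
  obtain ⟨r, hr, h0⟩ := intermediate_value_Ioo (by norm_num) hc
    (show (0:ℝ) ∈ _ by constructor <;> norm_num)
  refine ⟨r, ?_, h0⟩
  rw [abs_lt]
  constructor <;> linarith [hr.1, hr.2]

theorem cubic_strictMono : StrictMono (fun t : ℝ => 9 * t ^ 3 + 3 * t ^ 2 + 7 * t + 5) := by
  intro s t h
  have h1 : 0 < t - s := by linarith
  have h2 : 0 < 9 * (t ^ 2 + t * s + s ^ 2) + 3 * (t + s) + 7 := by
    nlinarith [sq_nonneg (t + s), sq_nonneg (t - s), sq_nonneg (t + s + 1)]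
  have := mul_pos h1 h2
  dsimp only
  linarith

/-- Value, up to a positive factor, of the quadratic at the rhombus boundary `p (1 - 2 w) = 1`. -/
theorem quadratic_boundary (w : ℝ) :
    (1 + w ^ 2) / 2 * w ^ 2 - (2 + (1 + w ^ 2) - 3 / 2 * (1 + w ^ 2) ^ 2) * (1 - 2 * w)
      + (2 - (1 + w ^ 2) / 2) * (1 - 2 * w) ^ 2 = -w * (3 - 8 * w + 2 * w ^ 2 + 3 * w ^ 4) := by
  ring

/-- With `m = -(1 + w²) / 2`, the sign of the cubic decides the sign of the boundary value. -/
theorem cubic_pos_iff {w : ℝ} (hw : 0 < w) (hw1 : w < 1) :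
    0 < 9 * (-(1 + w ^ 2) / 2) ^ 3 + 3 * (-(1 + w ^ 2) / 2) ^ 2 + 7 * (-(1 + w ^ 2) / 2) + 5 ↔
      0 < 3 - 8 * w + 2 * w ^ 2 + 3 * w ^ 4 := by
  have key : 8 * (1 - w ^ 2) * (9 * (-(1 + w ^ 2) / 2) ^ 3 + 3 * (-(1 + w ^ 2) / 2) ^ 2 +
      7 * (-(1 + w ^ 2) / 2) + 5) = (3 + 8 * w + 2 * w ^ 2 + 3 * w ^ 4) *
        (3 - 8 * w + 2 * w ^ 2 + 3 * w ^ 4) := by ring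
  have h1 : 0 < 8 * (1 - w ^ 2) := by nlinarith
  have h2 : 0 < 3 + 8 * w + 2 * w ^ 2 + 3 * w ^ 4 := by positivity
  rw [← mul_pos_iff_of_pos_left h1, key, mul_pos_iff_of_pos_left h2]

/-! ### Roots of the kite quadratic -/

/-- The quadratic satisfied by `p = -a b` on a kite. -/
def kiteQuadratic (m p : ℝ) : ℝ :=
  -m * (-2 * m - 1) * p ^ 2 - (2 - 2 * m - 6 * m ^ 2) * p + (2 + m)

/-- At most one root of the quadratic lies beyond the rhombus boundary. -/
theorem quadratic_root_unique {m w p q : ℝ} (hw : 0 < w) (hm : m = -(1 + w ^ 2) / 2)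
    (hpos : 0 < 3 - 8 * w + 2 * w ^ 2 + 3 * w ^ 4)
    (hp : 1 < p * (1 - 2 * w)) (hq : 1 < q * (1 - 2 * w))
    (hgp : kiteQuadratic m p = 0) (hgq : kiteQuadratic m q = 0) : p = q := by
  subst hm
  unfold kiteQuadratic at *
  by_contra hne
  -- Vieta's formula for the sum of two distinct roots; it turns the boundary value into the product
  -- below, which is positive if both roots lie beyond the boundary.
  have hV : (1 + w ^ 2) / 2 * w ^ 2 * (p + q) = 3 + w ^ 2 - 3 / 2 * (1 + w ^ 2) ^ 2 := by
    apply mul_left_cancel₀ (sub_ne_zero.2 hne)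
    linear_combination hgp - hgq
  have hb := quadratic_boundary w
  have h1 : (1 + w ^ 2) / 2 * w ^ 2 * ((p * (1 - 2 * w) - 1) * (q * (1 - 2 * w) - 1)) =
      -w * (3 - 8 * w + 2 * w ^ 2 + 3 * w ^ 4) := by
    linear_combination (1 - 2 * w) ^ 2 * (p * hV - hgp) - (1 - 2 * w) * hV
  have h2 : 0 < (1 + w ^ 2) / 2 * w ^ 2 * ((p * (1 - 2 * w) - 1) * (q * (1 - 2 * w) - 1)) :=
    mul_pos (by positivity) (mul_pos (by linarith) (by linarith))
  have h3 := mul_pos hw hpos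
  linarith

theorem quadratic_root_exists {m w : ℝ} (hw : 0 < w) (hm : m = -(1 + w ^ 2) / 2)
    (hw2 : 2 * w < 1) (hpos : 0 < 3 - 8 * w + 2 * w ^ 2 + 3 * w ^ 4) :
    ∃ p, 1 < p * (1 - 2 * w) ∧ kiteQuadratic m p = 0 := by
  subst hm
  have hd : 0 < 1 - 2 * w := by linarith
  set c := (1 + w ^ 2) / 2 * w ^ 2 with hc
  have hcpos : 0 < c := by positivity
  -- At the right endpoint `c` times the argument is at least 3, which exceeds the linear
  -- coefficient, at most `3 / 2`.
  have hP : 1 / (1 - 2 * w) < 1 / (1 - 2 * w) + 3 / c := by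
    have : 0 < 3 / c := by positivity
    linarith
  have hcont : ContinuousOn (kiteQuadratic (-(1 + w ^ 2) / 2))
      (Set.Icc (1 / (1 - 2 * w)) (1 / (1 - 2 * w) + 3 / c)) := by
    unfold kiteQuadratic
    fun_prop
  have h1 : kiteQuadratic (-(1 + w ^ 2) / 2) (1 / (1 - 2 * w)) < 0 := by
    have : kiteQuadratic (-(1 + w ^ 2) / 2) (1 / (1 - 2 * w)) =
        -w * (3 - 8 * w + 2 * w ^ 2 + 3 * w ^ 4) / (1 - 2 * w) ^ 2 := by
      have h0 : 1 / (1 - 2 * w) * (1 - 2 * w) = 1 := one_div_mul_cancel hd.ne'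
      rw [← quadratic_boundary, eq_div_iff (by positivity)]
      unfold kiteQuadratic
      linear_combination (c * (1 / (1 - 2 * w) * (1 - 2 * w) + 1) -
        (2 + (1 + w ^ 2) - 3 / 2 * (1 + w ^ 2) ^ 2) * (1 - 2 * w)) * h0
    rw [this]
    exact div_neg_of_neg_of_pos (by have := mul_pos hw hpos; linarith) (by positivity)
  have h2 : 0 < kiteQuadratic (-(1 + w ^ 2) / 2) (1 / (1 - 2 * w) + 3 / c) := by
    set P := 1 / (1 - 2 * w) + 3 / c
    have hPpos : 0 < P := by positivity
    have : 3 ≤ c * P := by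
      have h3 : c * P = c * (1 / (1 - 2 * w)) + 3 := by
        simp only [P]
        field_simp
      have : 0 < c * (1 / (1 - 2 * w)) := by positivity
      linarith
    have h4 : kiteQuadratic (-(1 + w ^ 2) / 2) P =
        (c * P - 3 + (3 / 2 + 2 * w ^ 2 + 3 / 2 * w ^ 4)) * P + (2 - (1 + w ^ 2) / 2) := by
      unfold kiteQuadratic
      rw [hc]
      ring
    rw [h4]
    have : 0 < c * P - 3 + (3 / 2 + 2 * w ^ 2 + 3 / 2 * w ^ 4) := by
      have : 0 < 3 / 2 + 2 * w ^ 2 + 3 / 2 * w ^ 4 := by positivity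
      linarith
    have := mul_pos this hPpos
    nlinarith
  obtain ⟨p, hp, h0⟩ := intermediate_value_Ioo hP.le hcont ⟨h1, h2⟩
  refine ⟨p, ?_, h0⟩
  have := hp.1
  rwa [div_lt_iff₀ hd] at this

/-- If the quartic were nonpositive, then `w ≥ 3/8`, and `1 - 2w` would lie left of the vertex of
the reciprocal quadratic. That quadratic would decrease up to `1 - 2w` and be nonnegative there, so
it could not vanish at the smaller point `1 / p`. -/
theorem boundary_pos_of_quadratic_root {m w p : ℝ} (hw : 0 < w) (hm : m = -(1 + w ^ 2) / 2)
    (hw2 : 2 * w < 1) (hp : 1 < p * (1 - 2 * w)) (hg : kiteQuadratic m p = 0) :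
    0 < 3 - 8 * w + 2 * w ^ 2 + 3 * w ^ 4 := by
  subst hm
  by_contra! hle
  unfold kiteQuadratic at hg
  have hd : 0 < 1 - 2 * w := by linarith
  have hp0 : 0 < p := (mul_pos_iff_of_pos_right hd).1 (by linarith)
  have hw3 : 3 / 8 ≤ w := by nlinarith [sq_nonneg w, sq_nonneg (w ^ 2)]
  -- compares the reciprocal quadratic at `1 / p` and at `1 - 2 w`
  have h1 : (1 - p * (1 - 2 * w)) * ((2 - (1 + w ^ 2) / 2) * (1 + p * (1 - 2 * w)) -
      (3 + w ^ 2 - 3 / 2 * (1 + w ^ 2) ^ 2) * p) =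
      p ^ 2 * (w * (3 - 8 * w + 2 * w ^ 2 + 3 * w ^ 4)) := by
    linear_combination hg
  have h2 : p ^ 2 * (w * (3 - 8 * w + 2 * w ^ 2 + 3 * w ^ 4)) ≤ 0 :=
    mul_nonpos_of_nonneg_of_nonpos (by positivity) (mul_nonpos_of_nonneg_of_nonpos hw.le hle)
  have h3 : (2 - (1 + w ^ 2) / 2) * (1 + p * (1 - 2 * w)) -
      (3 + w ^ 2 - 3 / 2 * (1 + w ^ 2) ^ 2) * p < 0 := by
    have h4 : (2 - (1 + w ^ 2) / 2) * (1 + p * (1 - 2 * w)) ≤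
        (2 - (1 + w ^ 2) / 2) * (2 * (p * (1 - 2 * w))) :=
      mul_le_mul_of_nonneg_left (by linarith) (by nlinarith)
    have h5 : (2 - (1 + w ^ 2) / 2) * (2 * (1 - 2 * w)) -
        (3 + w ^ 2 - 3 / 2 * (1 + w ^ 2) ^ 2) < 0 := by
      have hw4 : w ^ 2 < 1 / 4 := by nlinarith
      have : w ^ 4 < 1 / 16 := by nlinarith [sq_nonneg w]
      nlinarith [sq_nonneg w]
    nlinarith [mul_neg_of_neg_of_pos h5 hp0]
  have := mul_pos_of_neg_of_neg (show 1 - p * (1 - 2 * w) < 0 by linarith) h3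
  linarith

/-! ### Eliminating the multiplier -/

/-- The multiplier condition for the kite `a, b, I, -I` with strengths `1, 1, m, m`. -/
def KiteEquations (m a b l : ℝ) : Prop :=
  a * (1 / (1 + a ^ 2) + l) + b * (1 / (1 + b ^ 2) + l) = 0 ∧
    (1 / (1 + a ^ 2) + l) + (1 / (1 + b ^ 2) + l) + 2 * m * (1 / 4 + l) = 0 ∧
    (1 / (a - b) ^ 2 + l) * (a - b) + 2 * m * (a * (1 / (1 + a ^ 2) + l)) = 0

/-- The algebraic form of the kite equations, in terms of `p = -a b` and `(a - b)²`. -/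
def KiteCurve (m a b : ℝ) : Prop :=
  m < -1 / 2 ∧ 1 < -(a * b) ∧ (a - b) ^ 2 * (-2 * m - 1) * (-(a * b)) = (-(a * b) - 1) ^ 2 ∧
    kiteQuadratic m (-(a * b)) = 0

theorem KiteEquations.kiteCurve {m a b l : ℝ} (hm : m < 0) (hl : 0 < l) (hne : a ≠ b)
    (hsum : a + b ≠ 0) (h : KiteEquations m a b l) : KiteCurve m a b := by
  obtain ⟨h1, h2, h3⟩ := h
  have hd : a - b ≠ 0 := sub_ne_zero.2 hne
  have hs : 0 < (a - b) ^ 2 := by positivity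
  -- the difference of the two radial equations, divided by `a + b`
  have hA' : (1 / (1 + a ^ 2) + l) * (a - b) = 2 * m * (1 / 4 + l) * b := by
    linear_combination h1 - b * h2
  have hB' : (1 / (1 + b ^ 2) + l) * (a - b) = -(2 * m * (1 / 4 + l) * a) := by
    linear_combination -h1 + a * h2
  -- Uses `(1 + a²)(1 + b²) = (a - b)² + (1 + ab)²`. Cancelling `a + b` is where rhombi are
  -- excluded.
  have e1 : (a - b) ^ 2 = -m / 2 * (1 + 4 * l) * ((a - b) ^ 2 + (1 + a * b) ^ 2) := by
    have : (1 / (1 + b ^ 2) - 1 / (1 + a ^ 2)) * (a - b) = -(2 * m * (1 / 4 + l) * (a + b)) := by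
      linear_combination hB' - hA'
    field_simp at this
    have h' : (a + b) * ((a - b) ^ 2) =
        (a + b) * (-m / 2 * (1 + 4 * l) * ((a - b) ^ 2 + (1 + a * b) ^ 2)) := by
      linear_combination (1 / 4) * this
    exact mul_left_cancel₀ hsum h'
  have e2 : 1 + l * (a - b) ^ 2 = m ^ 2 * (-(a * b)) * (1 + 4 * l) := by
    have : (1 / (a - b) ^ 2 + l) * (a - b) * (a - b) + 2 * m * a * (2 * m * (1 / 4 + l) * b) = 0 := by
      linear_combination (a - b) * h3 - 2 * m * a * hA'
    field_simp at this
    linear_combination (1 / 4) * this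
  have e3 : 4 * l * (a - b) ^ 2 = -2 * m * (1 + 4 * l) * (-(a * b) - 1) := by
    field_simp at h2
    linear_combination (-m / 4) * (1 + 4 * l) * h2 + (4 * l + m * (1 + 4 * l)) * e1
  have hp : 1 < -(a * b) := by
    have h0 : 0 < 4 * l * (a - b) ^ 2 := by positivity
    rw [e3] at h0
    have : 0 < -2 * m * (1 + 4 * l) := mul_pos (by linarith) (by linarith)
    linarith [(mul_pos_iff_of_pos_left this).1 h0]
  have e4 : -m * (1 + 4 * l) * (1 + (-2 * m - 1) * (-(a * b))) = 2 := by
    linear_combination -2 * e2 + (1 / 2) * e3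
  have e5 : (a - b) ^ 2 * (-2 * m - 1) * (-(a * b)) = (-(a * b) - 1) ^ 2 := by
    linear_combination (1 + (-2 * m - 1) * (-(a * b))) * e1 +
      (1 / 2) * ((a - b) ^ 2 + (1 + a * b) ^ 2) * e4
  have hm2 : 0 < -2 * m - 1 := by
    have h0 : 0 < (-(a * b) - 1) ^ 2 := pow_pos (by linarith) 2
    rw [← e5] at h0
    have h1 : 0 < (a - b) ^ 2 * (-(a * b)) := by
      have : 0 < -(a * b) := by linarith
      positivity
    exact (mul_pos_iff_of_pos_left h1).1 (by linarith)
  refine ⟨by linarith, hp, e5, ?_⟩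
  have hp1 : -(a * b) - 1 ≠ 0 := by linarith
  unfold kiteQuadratic
  apply mul_left_cancel₀ hp1
  have e6 : (2 + m * (1 + (-2 * m - 1) * (-(a * b)))) * (a - b) ^ 2 = -4 * m * (-(a * b) - 1) := by
    linear_combination (-m * (1 + (-2 * m - 1) * (-(a * b)))) * e3 -
      ((a - b) ^ 2 + 2 * m * (-(a * b) - 1)) * e4
  linear_combination -((-2 * m - 1) * (-(a * b))) * e6 +
    (2 + m * (1 + (-2 * m - 1) * (-(a * b)))) * e5

/-- The value of `l` is forced by dividing `e3` by `e1` in the forward elimination. It makes the two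
axial weights `-b(a - b)` and `a(a - b)` over a common denominator, so the first equation is
immediate. -/
theorem KiteCurve.kiteEquations {m a b : ℝ} (h : KiteCurve m a b) :
    ∃ l, 0 < l ∧ KiteEquations m a b l := by
  obtain ⟨hm, hp, h5, hg⟩ := h
  unfold kiteQuadratic at hg
  have hne : a - b ≠ 0 := by
    intro h0
    have : a = b := by linarith
    subst this
    nlinarith [sq_nonneg a]
  have hs : 0 < (a - b) ^ 2 := by positivity
  have hQ : (1 + a ^ 2) * (1 + b ^ 2) = (a - b) ^ 2 * (1 + (-2 * m - 1) * (-(a * b))) := by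
    linear_combination -h5
  have hA : (1 / (1 + a ^ 2) + (-(a * b) - 1) / ((1 + a ^ 2) * (1 + b ^ 2))) =
      -b * (a - b) / ((1 + a ^ 2) * (1 + b ^ 2)) := by
    field_simp
    ring
  have hB : (1 / (1 + b ^ 2) + (-(a * b) - 1) / ((1 + a ^ 2) * (1 + b ^ 2))) =
      a * (a - b) / ((1 + a ^ 2) * (1 + b ^ 2)) := by
    field_simp
    ring
  have e6 : (2 + m * (1 + (-2 * m - 1) * (-(a * b)))) * (a - b) ^ 2 = -4 * m * (-(a * b) - 1) := by
    have h0 : (-2 * m - 1) * (-(a * b)) ≠ 0 := (mul_pos (by linarith) (by linarith)).ne'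
    apply mul_left_cancel₀ h0
    linear_combination (2 + m * (1 + (-2 * m - 1) * (-(a * b)))) * h5 - (-(a * b) - 1) * hg
  refine ⟨(-(a * b) - 1) / ((1 + a ^ 2) * (1 + b ^ 2)), div_pos (by linarith) (by positivity),
    ?_, ?_, ?_⟩
  · rw [hA, hB]
    ring
  · rw [hA, hB]
    field_simp
    linear_combination 2 * e6 + 2 * m * hQ
  · rw [hA]
    field_simp
    linear_combination hQ

/-- With `p = -(a * b)`, the curve gives `(p - 1)² - (2wp)² = w² p (a + b)²`, which is positive off
the rhombi. -/
theorem KiteCurve.lt_mul {m a b w : ℝ} (h : KiteCurve m a b) (hab : a + b ≠ 0) (hw : 0 < w)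
    (hm : m = -(1 + w ^ 2) / 2) : 1 < -(a * b) * (1 - 2 * w) := by
  obtain ⟨-, hp, h5, -⟩ := h
  subst hm
  have h1 : 0 < (a + b) ^ 2 := by positivity
  have hp0 : 0 < -(a * b) := by linarith
  have h2 : (2 * w * (-(a * b))) ^ 2 < (-(a * b) - 1) ^ 2 := by
    have : 0 < (a + b) ^ 2 * (w ^ 2 * (-(a * b))) := by positivity
    linarith
  have := abs_lt_of_sq_lt_sq h2 (by linarith)
  linarith [(abs_lt.1 this).2]

/-- The nondegenerate kites are obtained from one of them by choosing signs. -/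
theorem exists_kiteCurve_iff {m w : ℝ} (hw : 0 < w) (hm : m = -(1 + w ^ 2) / 2)
    (hw2 : 2 * w < 1) (hpos : 0 < 3 - 8 * w + 2 * w ^ 2 + 3 * w ^ 4) :
    ∃ s d : ℝ, 0 < s ∧ 0 < d ∧ ∀ a b : ℝ, (KiteCurve m a b ∧ a + b ≠ 0) ↔
      (a - b = s ∨ a - b = -s) ∧ (a + b = d ∨ a + b = -d) := by
  obtain ⟨p, hp, hg⟩ := quadratic_root_exists hw hm hw2 hpos
  have hd : 0 < 1 - 2 * w := by linarith
  have hp0 : 0 < p := (mul_pos_iff_of_pos_right hd).1 (by linarith)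
  have hp1 : 1 < p := by nlinarith [mul_pos hp0 hw]
  have hs0 : 0 < (p - 1) ^ 2 / (w ^ 2 * p) := by
    have : 0 < p - 1 := by linarith
    positivity
  have hd0 : 0 < (p - 1) ^ 2 / (w ^ 2 * p) - 4 * p := by
    rw [sub_pos, lt_div_iff₀ (by positivity)]
    have h1 : 2 * w * p < p - 1 := by linarith
    have h2 : 0 < 2 * w * p := by positivity
    nlinarith [mul_pos h2 (sub_pos.2 h1), mul_pos (h2.trans h1) (sub_pos.2 h1)]
  refine ⟨√((p - 1) ^ 2 / (w ^ 2 * p)), √((p - 1) ^ 2 / (w ^ 2 * p) - 4 * p),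
    Real.sqrt_pos.2 hs0, Real.sqrt_pos.2 hd0, fun a b => ?_⟩
  rw [← sq_eq_sq_iff_eq_or_eq_neg, ← sq_eq_sq_iff_eq_or_eq_neg, Real.sq_sqrt hs0.le,
    Real.sq_sqrt hd0.le]
  constructor
  · rintro ⟨h, hab⟩
    have hq : -(a * b) = p :=
      quadratic_root_unique hw hm hpos (h.lt_mul hab hw hm) hp h.2.2.2 hg
    have h1 : (a - b) ^ 2 = (p - 1) ^ 2 / (w ^ 2 * p) := by
      rw [eq_div_iff (by positivity)]
      have h5 := h.2.2.1
      rw [hq, hm] at h5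
      linear_combination h5
    refine ⟨h1, ?_⟩
    linear_combination h1 - 4 * hq
  · rintro ⟨h1, h2⟩
    have hq : -(a * b) = p := by linear_combination (h1 - h2) / 4
    refine ⟨⟨by subst hm; nlinarith, by linarith, ?_, by rwa [hq]⟩, ?_⟩
    · rw [eq_div_iff (by positivity)] at h1
      rw [hq, hm]
      linear_combination h1
    · intro h0
      rw [h0] at h2
      linarith

/-! ### Normal form of a kite -/

/-- The kite with vortices 3 and 4 at `±I` and vortices 1 and 2 on the real axis. -/
noncomputable def normalKite (a b : ℝ) : Fin 4 → ℂ := ![a, b, Complex.I, -Complex.I]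

theorem IsRelativeEquilibrium.similar {Γ : Fin 4 → ℝ} {x y : Fin 4 → ℂ} {ω : ℝ} {A B : ℂ}
    (hA : A ≠ 0) (hy : ∀ i, y i = A * x i + B) (h : IsRelativeEquilibrium Γ x ω) :
    IsRelativeEquilibrium Γ y (ω / ‖A‖ ^ 2) := by
  obtain ⟨hinj, hω, c, hc⟩ := h
  have hn : ‖A‖ ≠ 0 := norm_ne_zero_iff.2 hA
  refine ⟨fun i j hij => ?_, by positivity, A * c + B, fun i => ?_⟩
  · rw [hy, hy] at hij
    exact hinj (mul_left_cancel₀ hA (add_right_cancel hij))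
  · have h1 : ∀ j, (Γ j / dist (y i) (y j) ^ 2) • (y j - y i) =
        (A / (‖A‖ : ℂ) ^ 2) * ((Γ j / dist (x i) (x j) ^ 2) • (x j - x i)) := by
      intro j
      have : y i - y j = A * (x i - x j) := by rw [hy, hy]; ring
      rw [dist_eq_norm, this, norm_mul, ← dist_eq_norm,
        show y j - y i = A * (x j - x i) by rw [hy, hy]; ring]
      simp only [Complex.real_smul]
      push_cast
      rw [mul_pow, div_mul_eq_div_div]
      ring
    simp only [h1]
    rw [← Finset.mul_sum, ← hc i, hy]
    simp only [Complex.real_smul]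
    push_cast
    ring

theorem lambdaPrime_div (Γ : Fin 4 → ℝ) (ω r : ℝ) :
    lambdaPrime Γ (ω / r) = lambdaPrime Γ ω / r := by
  unfold lambdaPrime
  ring

theorem kitesLamPos_similar {m : ℝ} {x y : Fin 4 → ℂ} {A B : ℂ}
    (hA : A ≠ 0) (hy : ∀ i, y i = A * x i + B) (h : x ∈ kitesLamPos m) : y ∈ kitesLamPos m := by
  obtain ⟨⟨ω, hω, hl⟩, ⟨h23, h0, h1⟩, hr⟩ := h
  have hn : 0 < ‖A‖ := norm_pos_iff.2 hA
  have hd : ∀ i j, dist (y i) (y j) = ‖A‖ * dist (x i) (x j) := by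
    intro i j
    rw [dist_eq_norm, dist_eq_norm, ← norm_mul]
    congr 1
    rw [hy, hy]
    ring
  refine ⟨⟨_, hω.similar hA hy, ?_⟩, ⟨?_, ?_, ?_⟩, ?_⟩
  · rw [lambdaPrime_div]
    positivity
  · rw [← dist_pos, hd]
    have := dist_pos.2 h23
    positivity
  · rw [AffineSubspace.mem_perpBisector_iff_dist_eq] at h0 ⊢
    rw [hd, hd, h0]
  · rw [AffineSubspace.mem_perpBisector_iff_dist_eq] at h1 ⊢
    rw [hd, hd, h1]
  · simpa only [IsRhombus, hd, mul_right_inj' hn.ne'] using hr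

theorem dist_ofReal_I_sq (a : ℝ) : dist (a : ℂ) Complex.I ^ 2 = 1 + a ^ 2 := by
  rw [dist_eq_norm, Complex.sq_norm, Complex.normSq_apply]
  simp
  ring

theorem dist_ofReal_neg_I_sq (a : ℝ) : dist (a : ℂ) (-Complex.I) ^ 2 = 1 + a ^ 2 := by
  rw [dist_eq_norm, Complex.sq_norm, Complex.normSq_apply]
  simp
  ring

theorem dist_ofReal_sq (a b : ℝ) : dist (a : ℂ) (b : ℂ) ^ 2 = (a - b) ^ 2 := by
  rw [dist_eq_norm, Complex.sq_norm, Complex.normSq_apply]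
  simp
  ring

theorem dist_I_neg_I_sq : dist Complex.I (-Complex.I) ^ 2 = 4 := by
  rw [dist_eq_norm, Complex.sq_norm, Complex.normSq_apply]
  norm_num

theorem IsKite12.exists_normalKite {x : Fin 4 → ℂ} (h : IsKite12 x) :
    ∃ (A B : ℂ) (a b : ℝ), A ≠ 0 ∧ ∀ i, normalKite a b i = A * x i + B := by
  obtain ⟨h23, h0, h1⟩ := h
  have hne : x 2 - x 3 ≠ 0 := sub_ne_zero.2 h23
  set A := 2 * Complex.I / (x 2 - x 3) with hAdef
  have hA : A ≠ 0 := div_ne_zero (by simp) hne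
  set B := -A * (x 2 + x 3) / 2 with hBdef
  have h2 : A * x 2 + B = Complex.I := by rw [hBdef, hAdef]; field_simp; ring
  have h3 : A * x 3 + B = -Complex.I := by rw [hBdef, hAdef]; field_simp; ring
  have key : ∀ z : ℂ, z ∈ AffineSubspace.perpBisector (x 2) (x 3) →
      ((A * z + B).re : ℂ) = A * z + B := by
    intro z hz
    rw [AffineSubspace.mem_perpBisector_iff_dist_eq] at hz
    have hd : dist (A * z + B) Complex.I ^ 2 = dist (A * z + B) (-Complex.I) ^ 2 := by
      rw [← h3, ← h2]
      simp only [dist_add_right]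
      rw [dist_eq_norm, dist_eq_norm, ← mul_sub, ← mul_sub, norm_mul, norm_mul, ← dist_eq_norm,
        ← dist_eq_norm, hz]
    simp only [dist_eq_norm, Complex.sq_norm, Complex.normSq_apply] at hd
    apply Complex.ext
    · simp
    · simp only [Complex.sub_re, Complex.sub_im, Complex.neg_re, Complex.neg_im, Complex.I_re,
        Complex.I_im] at hd
      rw [Complex.ofReal_im]
      linarith
  refine ⟨A, B, (A * x 0 + B).re, (A * x 1 + B).re, hA, fun i => ?_⟩
  fin_cases i
  · exact key _ h0
  · exact key _ h1
  · exact h2.symm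
  · exact h3.symm

theorem sum_strengths (m : ℝ) : ∑ i, strengths m i = 2 + 2 * m := by
  simp [strengths, Fin.sum_univ_four]
  ring

/-- Mirror symmetry makes three of the eight real equations redundant. -/
theorem normalKite_equation_iff {m a b ω : ℝ} {c : ℂ} :
    (∀ i, (-ω) • (normalKite a b i - c) = ∑ j ∈ Finset.univ.erase i,
      (strengths m j / dist (normalKite a b i) (normalKite a b j) ^ 2) •
        (normalKite a b j - normalKite a b i)) ↔
      -ω * c.im = 0 ∧ -ω * (a - c.re) = (b - a) / (a - b) ^ 2 - 2 * m * a / (1 + a ^ 2) ∧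
        -ω * (b - c.re) = (a - b) / (a - b) ^ 2 - 2 * m * b / (1 + b ^ 2) ∧
        ω * c.re = a / (1 + a ^ 2) + b / (1 + b ^ 2) ∧
        -ω = -(1 / (1 + a ^ 2) + 1 / (1 + b ^ 2) + m / 2) := by
  have h : ∀ i, ∑ j ∈ Finset.univ.erase i,
      (strengths m j / dist (normalKite a b i) (normalKite a b j) ^ 2) •
        (normalKite a b j - normalKite a b i) = ∑ j,
      (strengths m j / dist (normalKite a b i) (normalKite a b j) ^ 2) •
        (normalKite a b j - normalKite a b i) := fun i => Finset.sum_erase _ (by simp)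
  have h4 : ∀ P : Fin 4 → Prop, (∀ i, P i) ↔ P 0 ∧ P 1 ∧ P 2 ∧ P 3 := fun P =>
    ⟨fun h => ⟨h 0, h 1, h 2, h 3⟩, fun h i => by fin_cases i <;> tauto⟩
  simp_rw [h]
  rw [h4]
  have e0 : normalKite a b 0 = a := rfl
  have e1 : normalKite a b 1 = b := rfl
  have e2 : normalKite a b 2 = Complex.I := rfl
  have e3 : normalKite a b 3 = -Complex.I := rfl
  have s0 : strengths m 0 = 1 := rfl
  have s1 : strengths m 1 = 1 := rfl
  have s2 : strengths m 2 = m := rfl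
  have s3 : strengths m 3 = m := rfl
  simp only [Fin.sum_univ_four, e0, e1, e2, e3, s0, s1, s2, s3, dist_comm Complex.I (_ : ℝ),
    dist_comm (-Complex.I) _, dist_ofReal_I_sq, dist_ofReal_neg_I_sq, dist_ofReal_sq,
    dist_I_neg_I_sq, sub_self, smul_zero, Complex.ext_iff, Complex.add_re, Complex.add_im,
    Complex.sub_re, Complex.sub_im, Complex.smul_re, Complex.smul_im, Complex.neg_re,
    Complex.neg_im, Complex.I_re, Complex.I_im, Complex.ofReal_re, Complex.ofReal_im, smul_eq_mul,
    Complex.zero_re, Complex.zero_im]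
  have hsq : (b - a) ^ 2 = (a - b) ^ 2 := by ring
  rw [hsq]
  constructor
  · rintro ⟨⟨h1, h2⟩, ⟨h3, -⟩, ⟨h5, h6⟩, -, h8⟩
    refine ⟨?_, ?_, ?_, ?_, ?_⟩
    · linear_combination -h2
    · linear_combination h1
    · linear_combination h3
    · linear_combination h5
    · linear_combination (h6 - h8) / 2
  · rintro ⟨h1, h2, h3, h4, h5⟩
    refine ⟨⟨?_, ?_⟩, ⟨?_, ?_⟩, ⟨?_, ?_⟩, ?_, ?_⟩
    · linear_combination h2
    · linear_combination -h1
    · linear_combination h3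
    · linear_combination -h1
    · linear_combination h4
    · linear_combination h5 - h1
    · linear_combination h4
    · linear_combination -h5 - h1

theorem normalKite_mem_iff {m a b : ℝ} :
    normalKite a b ∈ kitesLamPos m ↔
      m ≠ -1 ∧ a ≠ b ∧ a + b ≠ 0 ∧ ∃ l, 0 < l ∧ KiteEquations m a b l := by
  have hpb : ∀ t : ℝ, (t : ℂ) ∈ AffineSubspace.perpBisector Complex.I (-Complex.I) := by
    intro t
    rw [AffineSubspace.mem_perpBisector_iff_dist_eq, ← sq_eq_sq₀ dist_nonneg dist_nonneg,
      dist_ofReal_I_sq, dist_ofReal_neg_I_sq]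
  have hI : Complex.I ≠ -Complex.I := by norm_num [Complex.ext_iff]
  have hkite : IsKite12 (normalKite a b) := ⟨hI, hpb a, hpb b⟩
  have hrh : a ≠ b → (IsRhombus (normalKite a b) ↔ a + b = 0) := by
    intro hab
    have h1 : IsRhombus (normalKite a b) ↔ 1 + a ^ 2 = 1 + b ^ 2 := by
      change dist (a : ℂ) Complex.I = dist Complex.I (b : ℂ) ∧
        dist Complex.I (b : ℂ) = dist (b : ℂ) (-Complex.I) ∧
        dist (b : ℂ) (-Complex.I) = dist (-Complex.I) (a : ℂ) ↔ _
      rw [dist_comm Complex.I, dist_comm (-Complex.I)]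
      simp only [← sq_eq_sq₀ dist_nonneg dist_nonneg, dist_ofReal_I_sq, dist_ofReal_neg_I_sq,
        true_and]
      exact ⟨fun h => h.1, fun h => ⟨h, h.symm⟩⟩
    rw [h1, add_right_inj, sq_eq_sq_iff_eq_or_eq_neg]
    constructor
    · rintro (h | h)
      · exact absurd h hab
      · linarith
    · intro h
      right
      linarith
  have hinj : Function.Injective (normalKite a b) ↔ a ≠ b := by
    constructor
    · rintro h rfl
      exact absurd (@h 0 1 rfl) (by decide)
    · intro hab i j hij
      have ea : ∀ t : ℝ, (t : ℂ) ≠ Complex.I := fun t h => by simpa using congrArg Complex.im h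
      have eb : ∀ t : ℝ, (t : ℂ) ≠ -Complex.I := fun t h => by simpa using congrArg Complex.im h
      have hc : (a : ℂ) ≠ b := by exact_mod_cast hab
      fin_cases i <;> fin_cases j <;>
        simp [normalKite, ea, eb, hc, hc.symm, hI, hI.symm, (ea _).symm, (eb _).symm] at hij ⊢
  have hΓ := sum_strengths m
  constructor
  · rintro ⟨⟨ω, ⟨hi, hω, c, hc⟩, hl⟩, -, hr⟩
    have hab := hinj.1 hi
    rw [hrh hab] at hr
    rw [normalKite_equation_iff] at hc
    obtain ⟨-, h1, h2, h3, h4⟩ := hc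
    -- At zero total circulation `lambdaPrime` is a division by zero, hence 0 and not positive.
    have hm : m ≠ -1 := by
      rintro rfl
      simp [lambdaPrime, hΓ] at hl
    have hm' : 2 + 2 * m ≠ 0 := fun h => hm (by linarith)
    refine ⟨hm, hab, hr, _, hl, ?_⟩
    have hlω : lambdaPrime (strengths m) ω * (2 + 2 * m) = -ω := by
      rw [lambdaPrime, hΓ, div_mul_cancel₀ _ hm']
    set l := lambdaPrime (strengths m) ω
    -- The sum weighted by the strengths cancels all interactions, leaving the centre of vorticity.
    have hcl : ω * c.re = -l * (a + b) := by
      apply mul_left_cancel₀ hm'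
      linear_combination h1 + h2 + 2 * m * h3 + (a + b) * hlω
    refine ⟨?_, ?_, ?_⟩
    · linear_combination hcl - h3
    · linear_combination hlω + h4
    · linear_combination h1 - hcl + a * hlω
  · rintro ⟨hm, hab, hsum, l, hl, h1, h2, h3⟩
    have hm' : 2 + 2 * m ≠ 0 := fun h => hm (by linarith)
    refine ⟨⟨-(l * (2 + 2 * m)), ⟨hinj.2 hab, neg_ne_zero.2 (mul_ne_zero hl.ne' hm'),
      (((a + b) / (2 + 2 * m) : ℝ) : ℂ), ?_⟩, ?_⟩, hkite, fun h => hsum ((hrh hab).1 h)⟩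
    · rw [normalKite_equation_iff]
      have hc : l * (2 + 2 * m) * ((a + b) / (2 + 2 * m)) = l * (a + b) := by
        rw [mul_assoc, mul_div_cancel₀ _ hm']
      simp only [Complex.ofReal_im, Complex.ofReal_re]
      refine ⟨by ring, ?_, ?_, ?_, ?_⟩
      · linear_combination h3 - hc
      · linear_combination -h3 - hc + 2 * m * h1
      · linear_combination -hc - h1
      · linear_combination h2
    · rw [lambdaPrime, hΓ]
      rwa [neg_neg, mul_div_cancel_right₀ _ hm']

/-! ### Convexity -/

/-- For `l > 0` both weights in the first equation are positive, so `a` and `b` have opposite signs.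
-/
theorem KiteEquations.mul_neg {m a b l : ℝ} (hl : 0 < l) (hne : a ≠ b)
    (h : KiteEquations m a b l) : a * b < 0 := by
  have hA : 0 < 1 / (1 + a ^ 2) + l := by positivity
  have hB : 0 < 1 / (1 + b ^ 2) + l := by positivity
  have hb : b ≠ 0 := by
    rintro rfl
    have h1 : a * (1 / (1 + a ^ 2) + l) = 0 := by linear_combination h.1
    exact hne ((mul_eq_zero.1 h1).resolve_right hA.ne')
  have h1 : (1 / (1 + a ^ 2) + l) * (a * b) = -(b ^ 2 * (1 / (1 + b ^ 2) + l)) := by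
    linear_combination b * h.1
  have h2 : 0 < b ^ 2 * (1 / (1 + b ^ 2) + l) := by positivity
  by_contra! h3
  have := mul_nonneg hA.le h3
  linarith

theorem kiteEquations_iff {m a b : ℝ} (hm : m < 0) :
    (a ≠ b ∧ a + b ≠ 0 ∧ ∃ l, 0 < l ∧ KiteEquations m a b l) ↔ KiteCurve m a b ∧ a + b ≠ 0 := by
  constructor
  · rintro ⟨hne, hab, l, hl, h⟩
    exact ⟨h.kiteCurve hm hl hne hab, hab⟩
  · rintro ⟨h, hab⟩
    refine ⟨?_, hab, h.kiteEquations⟩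
    rintro rfl
    nlinarith [h.2.1, sq_nonneg a]

/-- A family is convex independent if each member is strictly separated from the others by a
real-linear functional. -/
theorem convexIndependent_of_separated {E ι : Type*} [AddCommGroup E] [Module ℝ E] {x : ι → E}
    (h : ∀ i, ∃ (f : E →ₗ[ℝ] ℝ) (c : ℝ), c < f (x i) ∧ ∀ j, j ≠ i → f (x j) ≤ c) :
    ConvexIndependent ℝ x := by
  intro s i hi
  by_contra his
  obtain ⟨f, c, hc, hj⟩ := h i
  have hsub : convexHull ℝ (x '' s) ⊆ {w | f w ≤ c} := by
    refine convexHull_min ?_ (convex_halfSpace_le f.isLinear c)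
    rintro _ ⟨j, hjs, rfl⟩
    exact hj j fun h => his (h ▸ hjs)
  exact absurd (hsub hi) (not_le.2 hc)

theorem convexIndependent_normalKite {a b : ℝ} (hab : a * b < 0) :
    ConvexIndependent ℝ (normalKite a b) := by
  have hre : ∀ {a b : ℝ}, a * b < 0 → ∃ (f : ℂ →ₗ[ℝ] ℝ), 0 < f a ∧ f b ≤ 0 ∧
      f Complex.I ≤ 0 ∧ f (-Complex.I) ≤ 0 := by
    intro a b hab
    rcases mul_neg_iff.1 hab with ⟨ha, hb⟩ | ⟨ha, hb⟩
    · exact ⟨Complex.reLm, by simpa using ha, by simpa using hb.le, by simp, by simp⟩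
    · exact ⟨-Complex.reLm, by simpa using ha, by simpa using hb.le, by simp, by simp⟩
  apply convexIndependent_of_separated
  intro i
  fin_cases i
  · obtain ⟨f, h0, h1, h2, h3⟩ := hre hab
    refine ⟨f, 0, h0, fun j hj => ?_⟩
    fin_cases j
    exacts [absurd rfl hj, h1, h2, h3]
  · obtain ⟨f, h0, h1, h2, h3⟩ := hre (mul_comm a b ▸ hab)
    refine ⟨f, 0, h0, fun j hj => ?_⟩
    fin_cases j
    exacts [h1, absurd rfl hj, h2, h3]
  · refine ⟨Complex.imLm, 0, by simp [normalKite], fun j hj => ?_⟩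
    fin_cases j <;> simp [normalKite] at hj ⊢
  · refine ⟨-Complex.imLm, 0, by simp [normalKite], fun j hj => ?_⟩
    fin_cases j <;> simp [normalKite] at hj ⊢

theorem ConvexIndependent.of_similar {x y : Fin 4 → ℂ} {A B : ℂ}
    (hy : ∀ i, y i = A * x i + B) (h : ConvexIndependent ℝ y) : ConvexIndependent ℝ x := by
  intro s i hi
  apply h s i
  let f : ℂ →ᵃ[ℝ] ℂ := (LinearMap.mulLeft ℝ A).toAffineMap + AffineMap.const ℝ ℂ B
  have hf : ∀ j, f (x j) = y j := fun j => by simp [f, hy]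
  have h1 := Set.mem_image_of_mem f hi
  rw [AffineMap.image_convexHull, Set.image_image] at h1
  simpa only [hf] using h1

theorem convexIndependent_of_mem_kitesLamPos {m : ℝ} {x : Fin 4 → ℂ} (hx : x ∈ kitesLamPos m) :
    ConvexIndependent ℝ x := by
  obtain ⟨A, B, a, b, hA, hy⟩ := hx.2.1.exists_normalKite
  obtain ⟨-, hne, -, l, hl, h⟩ := normalKite_mem_iff.1 (kitesLamPos_similar hA hy hx)
  exact (convexIndependent_normalKite (h.mul_neg hl hne)).of_similar hy

/-! ### Counting similarity classes -/

/-- A map `z ↦ A z + B` fixing `I` and `-I` is the identity, so counting classes is counting pairs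
`(a, b)`. -/
theorem normalKite_class_injective :
    Function.Injective fun q : ℝ × ℝ => Quotient.mk configSetoid (normalKite q.1 q.2) := by
  rintro ⟨a, b⟩ ⟨a', b'⟩ h
  obtain ⟨A, B, -, h⟩ := Quotient.exact h
  have h2 : Complex.I = A * Complex.I + B := h 2
  have h3 : -Complex.I = A * -Complex.I + B := h 3
  have hB : B = 0 := by linear_combination -(h2 + h3) / 2
  have hA : A = 1 := by
    apply mul_right_cancel₀ Complex.I_ne_zero
    linear_combination (h3 - h2) / 2
  subst hA hB
  have h0 : (a' : ℂ) = 1 * a + 0 := h 0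
  have h1 : (b' : ℂ) = 1 * b + 0 := h 1
  simp only [one_mul, add_zero, Complex.ofReal_inj] at h0 h1
  rw [h0, h1]

theorem configClasses_kitesLamPos (m : ℝ) :
    configClasses (kitesLamPos m) =
      (fun q : ℝ × ℝ => Quotient.mk configSetoid (normalKite q.1 q.2)) ''
        {q | normalKite q.1 q.2 ∈ kitesLamPos m} := by
  ext c
  constructor
  · rintro ⟨x, hx, rfl⟩
    obtain ⟨A, B, a, b, hA, hy⟩ := hx.2.1.exists_normalKite
    exact ⟨(a, b), kitesLamPos_similar hA hy hx, (@Quotient.sound _ configSetoid _ _ ⟨A, B, hA, hy⟩).symm⟩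
  · rintro ⟨q, hq, rfl⟩
    exact ⟨_, hq, rfl⟩

theorem exists_width {m : ℝ} (hm : m < -1 / 2) : ∃ w, 0 < w ∧ m = -(1 + w ^ 2) / 2 := by
  have h : 0 < -2 * m - 1 := by linarith
  refine ⟨√(-2 * m - 1), Real.sqrt_pos.2 h, ?_⟩
  rw [Real.sq_sqrt h.le]
  ring

theorem encard_classes {m w : ℝ} (hw : 0 < w) (hm : m = -(1 + w ^ 2) / 2)
    (hw2 : 2 * w < 1) (hpos : 0 < 3 - 8 * w + 2 * w ^ 2 + 3 * w ^ 4) :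
    (configClasses (kitesLamPos m)).encard = 4 := by
  obtain ⟨s, d, hs, hd, h⟩ := exists_kiteCurve_iff hw hm hw2 hpos
  have hm0 : m < 0 := by nlinarith
  have hm1 : m ≠ -1 := by nlinarith
  rw [configClasses_kitesLamPos, normalKite_class_injective.encard_image]
  have hset : {q : ℝ × ℝ | normalKite q.1 q.2 ∈ kitesLamPos m} =
      (fun r : ℝ × ℝ => ((r.1 + r.2) / 2, (r.2 - r.1) / 2)) '' (({s, -s} : Set ℝ) ×ˢ {d, -d}) := by
    ext ⟨a, b⟩
    have : normalKite a b ∈ kitesLamPos m ↔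
        (a - b = s ∨ a - b = -s) ∧ (a + b = d ∨ a + b = -d) := by
      rw [normalKite_mem_iff, kiteEquations_iff hm0, h a b]
      exact and_iff_right hm1
    rw [Set.mem_ofPred_eq, this]
    constructor
    · intro hab
      refine ⟨(a - b, a + b), hab, ?_⟩
      ext <;> dsimp only <;> ring
    · rintro ⟨⟨u, v⟩, huv, he⟩
      obtain ⟨rfl, rfl⟩ := Prod.mk.inj he
      have h1 : (u + v) / 2 - (v - u) / 2 = u := by ring
      have h2 : (u + v) / 2 + (v - u) / 2 = v := by ring
      rw [h1, h2]
      exact huv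
  have hinj : Function.Injective (fun r : ℝ × ℝ => ((r.1 + r.2) / 2, (r.2 - r.1) / 2)) := by
    rintro ⟨u, v⟩ ⟨u', v'⟩ he
    obtain ⟨h1, h2⟩ := Prod.mk.inj he
    ext <;> dsimp only <;> linarith
  rw [hset, hinj.encard_image, Set.encard_prod, Set.encard_pair (by linarith : s ≠ -s),
    Set.encard_pair (by linarith : d ≠ -d)]
  norm_num

theorem mainTheorem6 :
    ∃ mstar : ℝ,
      (∀ t : ℝ, 9 * t ^ 3 + 3 * t ^ 2 + 7 * t + 5 = 0 ↔ t = mstar) ∧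
      |mstar - (-0.5951)| < 0.00005 ∧
      (∀ m : ℝ, mstar < m → m < -1 / 2 →
        (configClasses (kitesLamPos m)).encard = 4 ∧
        ∀ x ∈ kitesLamPos m, ConvexIndependent ℝ x) ∧
      (∀ m : ℝ, m < 0 → m ≠ -1 → ¬ (mstar < m ∧ m < -1 / 2) →
        kitesLamPos m = ∅) := by
  obtain ⟨r, hr, h0⟩ := exists_cubic_root
  have hlt : ∀ m : ℝ, r < m ↔ 0 < 9 * m ^ 3 + 3 * m ^ 2 + 7 * m + 5 := by
    intro m
    have := cubic_strictMono.lt_iff_lt (a := r) (b := m)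
    rw [← this, h0]
  refine ⟨r, fun t => ?_, hr, fun m h1 h2 => ⟨?_, fun x => convexIndependent_of_mem_kitesLamPos⟩,
    fun m hm _ hout => ?_⟩
  · rw [← cubic_strictMono.injective.eq_iff (a := t) (b := r)]
    rw [h0]
  · obtain ⟨w, hw, hmw⟩ := exists_width h2
    -- Here `w² = -2m - 1 < 0.1903`, since `m > -0.59515`.
    have hw2 : 2 * w < 1 := by
      have := (abs_lt.1 hr).1
      nlinarith
    refine encard_classes hw hmw hw2 ((cubic_pos_iff hw (by linarith)).1 ?_)
    rw [← hmw]
    exact (hlt m).1 h1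
  · rw [Set.eq_empty_iff_forall_notMem]
    intro x hx
    obtain ⟨A, B, a, b, hA, hy⟩ := hx.2.1.exists_normalKite
    obtain ⟨h, hab⟩ :=
      (kiteEquations_iff hm).1 (normalKite_mem_iff.1 (kitesLamPos_similar hA hy hx)).2
    obtain ⟨w, hw, hmw⟩ := exists_width h.1
    have hp := h.lt_mul hab hw hmw
    have hp0 : 0 < -(a * b) := by linarith [h.2.1]
    have hw2 : 2 * w < 1 := by linarith [(mul_pos_iff_of_pos_left hp0).1 (one_pos.trans hp)]
    refine hout ⟨(hlt m).2 ?_, h.1⟩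
    rw [hmw, cubic_pos_iff hw (by linarith)]
    exact boundary_pos_of_quadratic_root hw hmw hw2 hp h.2.2.2
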